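/- For $N\in\mathbf N=\{1,2,\dots\}$ and $1\le p\le\infty$ let $L_p^N$ be the space of functions $f:\{0,\dots,N-1\}\to\mathbf R$ with the norm $\|f\|_{L_p^N}=\bigl(\frac1N\sum_{i=0}^{N-1}|f(i)|^p\bigr)^{1/p}$ for $p<\infty$ and $\|f\|_{L_\infty^N}=\max_{0\le i<N}|f(i)|$, let $\mathcal B(L_p^N)=\{f:\|f\|_{L_p^N}\le1\}$ be its unit ball, and let $J_{pq}^N:L_p^N\to L_q^N$, $J_{pq}^Nf=f$, be the identity operator. Quantum algorithms are understood in the query model of quantum information-based complexity. A quantum query on functions from $D$ to $K$ is a tuple $Q=(m,m',m'',Z,\tau,\beta)$ with $m,m',m''\in\mathbf N$, $m'+m''\le m$, a nonempty set $Z\subseteq\{0,\dots,2^{m'}-1\}$ and arbitrary maps $\tau:Z\to D$, $\beta:K\to\{0,\dots,2^{m''}-1\}$; it acts on the space $H_m=(\mathbf C^2)^{\otimes m}$ of $m$ qubits by the unitary operator $Q_f$ with $Q_f|i\rangle|x\rangle|y\rangle=|i\rangle|x\oplus\beta(f(\tau(i)))\rangle|y\rangle$ if $i\in Z$, and $Q_f|i\rangle|x\rangle|y\rangle=|i\rangle|x\rangle|y\rangle$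 otherwise, where $|i\rangle,|x\rangle,|y\rangle$ run through the canonical basis states of $m'$, $m''$ and $m-m'-m''$ qubits, and $\oplus$ is addition modulo $2^{m''}$. An algorithm without measurement, with $n\ge 0$ queries, consists of a query $Q$ and unitary operators $U_0,\dots,U_n$ on $H_m$, and realizes $A_f=U_nQ_fU_{n-1}\cdots U_1Q_fU_0$. A quantum algorithm $A$ with values in a normed space $G$ runs finitely many (at least one) such algorithms $A_0,\dots,A_{k-1}$ one after the other, each started in a canonical basis state that is a function of the previously measured outcomes, and each followed by a measurement in the canonical basis; its output is a function, with values in $G$, of all $k$ outcomes. Let $A(f)$ be the distribution of its output on input $f$, and let $n_q(A)$ be the total number of queries of $A_0,\dots,A_{k-1}$. For a set $F$ of functions from $D$ to $K$ and a mapping $S:F\to G$, the $n$-th minimal query error is $$e_n^{\rm q}(S,F)=\inf_{A:\,n_q(A)\le n}\ \sup_{f\in F}\ \inf\bigl\{\varepsilon\ge0:\ \mathbf P\{\|S(f)-\zeta\|_G>\varepsilon\}\le 1/4,\ \zeta\sim A(f)\bigr\}\in[0,\infty].$$ **Statement.** Let $1\le p,q\le\infty$. There are constants $c_0,c_1>0$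 (depending only on $p$ and $q$) such that for all $n,N\in\mathbf N$ with $N>4$ and $n\le c_0N$ the following hold, where $\log=\log_2$: $$e_n^{\rm q}(J_{pq}^N,\mathcal B(L_p^N))\ge c_1\quad\text{if }2<q\le\infty,$$ $$e_n^{\rm q}(J_{p,2}^N,\mathcal B(L_p^N))\ge c_1(\log\log N)^{-3/2}(\log\log\log N)^{-1}\quad\text{if }q=2,$$ $$e_n^{\rm q}(J_{pq}^N,\mathcal B(L_p^N))\ge c_1(\log N)^{1-2/q}\quad\text{if }1\le q<2.$$ -/

import Mathlib

open scoped ENNReal NNReal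

noncomputable section

namespace QuantumIBC

/-! ### Quantum queries and quantum algorithms

The Hilbert space `H_m` is the `m`-fold tensor power of `ℂ²`; its canonical basis is indexed by
`Fin (2 ^ m)`, and operators on `H_m` are given by their matrices in this basis. -/

/-- The identification of the canonical basis of `H_m` with the one of
`H_{m'} ⊗ H_{m''} ⊗ H_{m - m' - m''}` by splitting the binary expansion of an index, the leading
digits first: the triple `(i, x, y)` corresponds to `(i * 2 ^ m'' + x) * 2 ^ (m - m' - m'') + y`. -/
def splitBasis (m m' m'' : ℕ) (h : m' + m'' ≤ m) :
    Fin (2 ^ m) ≃ (Fin (2 ^ m') × Fin (2 ^ m'')) × Fin (2 ^ (m - m' - m'')) :=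
  (finCongr (by rw [← pow_add, ← pow_add]; congr 1; omega)).trans
    (finProdFinEquiv.symm.trans (finProdFinEquiv.symm.prodCongr (Equiv.refl _)))

/-- A quantum query on functions from `D` to `K`: a tuple `(m, m', m'', Z, τ, β)`. -/
structure QuantumQuery (D K : Type*) where
  m : ℕ
  m' : ℕ
  m'' : ℕ
  one_le_m' : 1 ≤ m'
  one_le_m'' : 1 ≤ m''
  add_le : m' + m'' ≤ m
  Z : Set (Fin (2 ^ m'))
  Z_nonempty : Z.Nonempty
  τ : Z → D
  β : K → Fin (2 ^ m'')

namespace QuantumQuery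

variable {D K : Type*}

open Classical in
/-- The action of the query operator on basis vectors,
`|i⟩|x⟩|y⟩ ↦ |i⟩|x ⊕ β (f (τ i))⟩|y⟩` if `i ∈ Z` and `|i⟩|x⟩|y⟩ ↦ |i⟩|x⟩|y⟩` otherwise.
Addition in `Fin (2 ^ m'')` is addition modulo `2 ^ m''`. -/
def basisMap (Q : QuantumQuery D K) (f : D → K) (a : Fin (2 ^ Q.m)) : Fin (2 ^ Q.m) :=
  let s := splitBasis Q.m Q.m' Q.m'' Q.add_le
  let i := (s a).1.1
  let x := (s a).1.2
  let y := (s a).2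
  if hi : i ∈ Q.Z then s.symm ((i, x + Q.β (f (Q.τ ⟨i, hi⟩))), y) else a

/-- The matrix of the query operator `Q_f` in the canonical basis. -/
def op (Q : QuantumQuery D K) (f : D → K) : Matrix (Fin (2 ^ Q.m)) (Fin (2 ^ Q.m)) ℂ :=
  Matrix.of fun a b => if a = Q.basisMap f b then 1 else 0

end QuantumQuery

/-- A quantum algorithm without measurement: `A = (Q, (U_j)_{j=0}^n)` with unitary `U_j`. -/
structure UnmeasuredAlgorithm (D K : Type*) where
  Q : QuantumQuery D K
  n : ℕ
  U : Fin (n + 1) → Matrix.unitaryGroup (Fin (2 ^ Q.m)) ℂ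

namespace UnmeasuredAlgorithm

variable {D K : Type*}

/-- The number of qubits. -/
def m (A : UnmeasuredAlgorithm D K) : ℕ := A.Q.m

/-- The matrix of `A_f = U_n Q_f U_{n-1} ⋯ U_1 Q_f U_0` in the canonical basis. -/
def op (A : UnmeasuredAlgorithm D K) (f : D → K) : Matrix (Fin (2 ^ A.m)) (Fin (2 ^ A.m)) ℂ :=
  Fin.induction (motive := fun _ => Matrix (Fin (2 ^ A.Q.m)) (Fin (2 ^ A.Q.m)) ℂ)
    (A.U 0 : Matrix (Fin (2 ^ A.Q.m)) (Fin (2 ^ A.Q.m)) ℂ)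
    (fun j M => (A.U j.succ : Matrix (Fin (2 ^ A.Q.m)) (Fin (2 ^ A.Q.m)) ℂ) * A.Q.op f * M)
    (Fin.last A.n)

end UnmeasuredAlgorithm

/-- A quantum algorithm with `k ≥ 1` measurements and output in `G`. The initial basis state
`b l` of the `l`-th stage is a function of the outcomes of all earlier stages (so `b 0` is a
constant), and `φ` maps the measured outcomes to the output. -/
structure QuantumAlgorithm (D K G : Type*) where
  k : ℕ
  one_le_k : 1 ≤ k
  A : Fin k → UnmeasuredAlgorithm D K
  b : (l : Fin k) → ((i : Set.Iio l) → Fin (2 ^ (A i).m)) → Fin (2 ^ (A l).m)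
  φ : ((l : Fin k) → Fin (2 ^ (A l).m)) → G

namespace QuantumAlgorithm

variable {D K G : Type*}

/-- The probability `p_{A,f}(x_0, …, x_{k-1})` of the sequence `x` of measured outcomes. -/
def outcomeProb (A : QuantumAlgorithm D K G) (f : D → K)
    (x : (l : Fin A.k) → Fin (2 ^ (A.A l).m)) : ℝ :=
  ∏ l, ‖(A.A l).op f (x l) (A.b l fun i => x i)‖ ^ 2

open Classical in
/-- The output distribution: `A(f)(C)` for `C ⊆ G`. -/
def outputProb (A : QuantumAlgorithm D K G) (f : D → K) (C : Set G) : ℝ :=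
  ∑ x with A.φ x ∈ C, A.outcomeProb f x

/-- The number `n_q(A)` of queries. -/
def numQueries (A : QuantumAlgorithm D K G) : ℕ := ∑ l, (A.A l).n

end QuantumAlgorithm

/-! ### Errors -/

section Error

variable {D K G : Type*} [NormedAddCommGroup G] {F : Set (D → K)}

/-- `e(S, A, f, θ)`, the infimum of all `ε ≥ 0` with `P(‖S(f) - ζ‖ > ε) ≤ θ`, where `ζ` has
distribution `A(f)`. -/
def errorAt (S : F → G) (A : QuantumAlgorithm D K G) (f : F) (θ : ℝ) : ℝ≥0∞ :=
  ⨅ (ε : ℝ≥0) (_ : A.outputProb f {g | (ε : ℝ) < ‖S f - g‖} ≤ θ), (ε : ℝ≥0∞)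

/-- `e(S, A, F, θ)`, the supremum of the errors over the class `F` (possibly `∞`). -/
def algError (S : F → G) (A : QuantumAlgorithm D K G) (θ : ℝ) : ℝ≥0∞ :=
  ⨆ f : F, errorAt S A f θ

/-- `e_n^q(S, F, θ)`, the infimum of the errors over all algorithms with at most `n` queries. -/
def minErrorWith (n : ℕ) (S : F → G) (θ : ℝ) : ℝ≥0∞ :=
  ⨅ (A : QuantumAlgorithm D K G) (_ : A.numQueries ≤ n), algError S A θ

/-- The `n`-th minimal query error `e_n^q(S, F) = e_n^q(S, F, 1/4)`. -/
def minQueryError (n : ℕ) (S : F → G) : ℝ≥0∞ := minErrorWith n S (1 / 4)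

end Error

/-! ### The spaces `L_p^N` -/

/-- The space `L_p^N` of all functions from `{0, …, N - 1}` to `ℝ`, with the normalized norm. -/
def LpN (_p : ℝ≥0∞) (N : ℕ) : Type := Fin N → ℝ

namespace LpN

variable {p : ℝ≥0∞} {N : ℕ}

instance : AddCommGroup (LpN p N) := inferInstanceAs (AddCommGroup (Fin N → ℝ))

instance : Module ℝ (LpN p N) := inferInstanceAs (Module ℝ (Fin N → ℝ))

instance : CoeFun (LpN p N) fun _ => Fin N → ℝ := ⟨fun f => f⟩

/-- Functions on `{0, …, N - 1}` as elements of `L_p^N`. -/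
def of (p : ℝ≥0∞) (N : ℕ) : (Fin N → ℝ) ≃ₗ[ℝ] LpN p N := LinearEquiv.refl ℝ (Fin N → ℝ)

instance : Norm (LpN p N) where
  norm f := if p = ∞ then ⨆ i, |f i|
    else ((1 / N : ℝ) * ∑ i, |f i| ^ p.toReal) ^ (1 / p.toReal)

theorem norm_def (f : LpN p N) : ‖f‖ = if p = ∞ then ⨆ i, |f i|
    else ((1 / N : ℝ) * ∑ i, |f i| ^ p.toReal) ^ (1 / p.toReal) := rfl

theorem norm_eq_piLp [hp : Fact (1 ≤ p)] (f : LpN p N) :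
    ‖f‖ = (1 / N : ℝ) ^ (1 / p.toReal) * ‖WithLp.toLp p ((of p N).symm f)‖ := by
  rw [norm_def]
  split_ifs with h
  · subst h
    simp only [ENNReal.toReal_top, div_zero, Real.rpow_zero, one_mul, PiLp.norm_eq_ciSup]
    rfl
  · have h0 : 0 < p.toReal := ENNReal.toReal_pos (by
      rintro rfl
      exact absurd hp.out (by simp)) h
    rw [PiLp.norm_eq_sum h0, Real.mul_rpow (by positivity)
      (Finset.sum_nonneg fun i _ => by positivity)]
    rfl

theorem normCore [Fact (1 ≤ p)] : NormedSpace.Core ℝ (LpN p N) where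
  norm_nonneg f := by rw [norm_eq_piLp]; positivity
  norm_smul c f := by
    rw [norm_eq_piLp, norm_eq_piLp, map_smul, WithLp.toLp_smul, norm_smul]; ring
  norm_triangle f g := by
    rw [norm_eq_piLp, norm_eq_piLp, norm_eq_piLp, map_add, WithLp.toLp_add, ← mul_add]
    exact mul_le_mul_of_nonneg_left (norm_add_le _ _) (by positivity)
  norm_eq_zero_iff f := by
    rcases Nat.eq_zero_or_pos N with rfl | hN
    · have : Subsingleton (LpN p 0) := inferInstanceAs (Subsingleton (Fin 0 → ℝ))
      refine ⟨fun _ => Subsingleton.elim _ _, fun _ => ?_⟩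
      have h : WithLp.toLp p ((of p 0).symm f) = 0 := Subsingleton.elim _ _
      rw [norm_eq_piLp, h, norm_zero, mul_zero]
    · have hs : (1 / N : ℝ) ^ (1 / p.toReal) ≠ 0 := by positivity
      rw [norm_eq_piLp, mul_eq_zero, or_iff_right hs, norm_eq_zero, WithLp.toLp_eq_zero,
        LinearEquiv.map_eq_zero_iff]

instance [Fact (1 ≤ p)] : NormedAddCommGroup (LpN p N) := NormedAddCommGroup.ofCore normCore

instance [Fact (1 ≤ p)] : NormedSpace ℝ (LpN p N) := NormedSpace.ofCore normCore

/-- The unit ball of `L_p^N`, as a set of functions. -/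
def unitBall (p : ℝ≥0∞) (N : ℕ) : Set (Fin N → ℝ) := {f | ‖of p N f‖ ≤ 1}

/-- The identity operator `J_{pq}^N : L_p^N → L_q^N`. -/
def J (p q : ℝ≥0∞) (N : ℕ) : LpN p N →ₗ[ℝ] LpN q N :=
  ((of p N).symm.trans (of q N)).toLinearMap

end LpN

/-- The `n`-th minimal query error `e_n^q(J_{pq}^N, B(L_p^N))` of the embedding `J_{pq}^N` on the
unit ball of `L_p^N`. -/
def embeddingError (n : ℕ) (p q : ℝ≥0∞) (N : ℕ) [Fact (1 ≤ q)] : ℝ≥0∞ :=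
  minQueryError n fun f : LpN.unitBall p N => LpN.J p q N (LpN.of p N f)

end QuantumIBC

end

/-! The sign functions `{-1, 1}^N` lie in the unit ball of every `L_p^N`, and few queries cannot
identify a sign function even roughly. This gives one constant lower bound for all `p` and `q`; in
the cases `q ≤ 2` the logarithmic factors are at most 1, so the claims follow.

Each query raises the degree of an amplitude, as a function on the cube, by at most one. For a fixed
sequence of outcomes the product of the amplitudes of all stages thus has degree at most `n`, and
its squared modulus is the probability of that sequence. By Parseval and Cauchy–Schwarz, the squared
modulus at one point is at most `numLow n` times its mean over the cube
(`norm_sq_le_of_mem_lowDegree`). An output within `1/16` of a sign function is that close to at most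
`numLow (N / 16)` of them (`ncard_signFun_near_le`). Summing over outcomes, the success
probabilities over the cube total at most `numLow (N / 16) * numLow n`
(`QuantumAlgorithm.sum_outputProb_le`). An error below `1/16` would make this total at least `3/4 *
2 ^ N`, which the entropy-type estimate `numLow_mul_numLow_lt` excludes. -/

open scoped ENNReal NNReal

namespace QuantumIBC

/-! ### Walsh functions and functions of low degree on the cube -/

section Walsh

variable {ι : Type*}

/-- The sign `±1` encoded by a Boolean. -/
def boolSign (R : Type*) [Ring R] (b : Bool) : R := if b then -1 else 1

theorem boolSign_mul_self {R : Type*} [Ring R] (b : Bool) : boolSign R b * boolSign R b = 1 := by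
  cases b <;> simp [boolSign]

/-- The Walsh function with index set `S`. -/
def walsh (S : Finset ι) (s : ι → Bool) : ℂ := ∏ i ∈ S, boolSign ℂ (s i)

theorem norm_walsh (S : Finset ι) (s : ι → Bool) : ‖walsh S s‖ = 1 := by
  rw [walsh, norm_prod]
  exact Finset.prod_eq_one fun i _ => by cases s i <;> simp [boolSign]

theorem star_walsh (S : Finset ι) (s : ι → Bool) : star (walsh S s) = walsh S s := by
  rw [walsh, star_prod]
  exact Finset.prod_congr rfl fun i _ => by cases s i <;> simp [boolSign]

variable [Fintype ι]

/-- The number of index sets of size at most `n`. -/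
def numLow (ι : Type*) [Fintype ι] (n : ℕ) : ℕ :=
  (Finset.univ.filter fun S : Finset ι => S.card ≤ n).card

/-- Chernoff-type bound: in the binomial expansion of `(1 + t) ^ N` over index sets, each set of
size at most `n` contributes at least `t ^ n`. -/
theorem numLow_mul_le {n : ℕ} {t : ℝ} (ht : 0 ≤ t) (ht1 : t ≤ 1) :
    numLow ι n * t ^ n ≤ (1 + t) ^ Fintype.card ι := by
  rw [numLow, ← nsmul_eq_mul, ← Finset.sum_const, add_comm,
    ← Fintype.sum_pow_mul_eq_add_pow]
  refine (Finset.sum_le_sum fun S hS => ?_).trans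
    (Finset.sum_le_univ_sum_of_nonneg fun S => by positivity)
  rw [one_pow, mul_one]
  exact pow_le_pow_of_le_one ht ht1 (Finset.mem_filter.mp hS).2

/-- A point is determined by the set of coordinates where it differs from `s`, so the number that
bounds the dimension of `lowDegree` also bounds Hamming balls. -/
theorem card_hammingDist_le (s : ι → Bool) (d : ℕ) :
    {g : ι → Bool | hammingDist s g ≤ d}.ncard ≤ numLow ι d := by
  rw [numLow, ← Set.ncard_coe_finset]
  refine Set.ncard_le_ncard_of_injOn (fun g => Finset.univ.filter fun i => s i ≠ g i)
    (fun g hg => Finset.mem_filter.mpr ⟨Finset.mem_univ _, hg⟩) ?_ (Set.toFinite _)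
  intro g _ g' _ h
  ext i
  have := Finset.ext_iff.mp h i
  simp only [Finset.mem_filter, Finset.mem_univ, true_and] at this
  revert this
  cases s i <;> cases g i <;> cases g' i <;> simp

variable [DecidableEq ι]

theorem walsh_mul_walsh (S T : Finset ι) (s : ι → Bool) :
    walsh S s * walsh T s = walsh (symmDiff S T) s := by
  have h (U : Finset ι) : walsh U s = ∏ i, if i ∈ U then boolSign ℂ (s i) else 1 :=
    (Finset.prod_ite_mem_eq ..).symm
  rw [h, h, h, ← Finset.prod_mul_distrib]
  refine Finset.prod_congr rfl fun i _ => ?_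
  by_cases hS : i ∈ S <;> by_cases hT : i ∈ T <;>
    simp [hS, hT, Finset.mem_symmDiff, boolSign_mul_self]

theorem sum_walsh (S : Finset ι) :
    ∑ s : ι → Bool, walsh S s = if S = ∅ then 2 ^ Fintype.card ι else 0 := by
  have h : ∑ s : ι → Bool, walsh S s
      = ∏ i : ι, ∑ b : Bool, if i ∈ S then boolSign ℂ b else 1 := by
    rw [Finset.prod_univ_sum, Fintype.piFinset_univ]
    exact Finset.sum_congr rfl fun s _ => (Finset.prod_ite_mem_eq ..).symm
  rw [h]
  split_ifs with hS
  · subst hS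
    simp
  · obtain ⟨i, hi⟩ := Finset.nonempty_iff_ne_empty.mpr hS
    exact Finset.prod_eq_zero (Finset.mem_univ i) (by simp [hi, boolSign])

/-- Parseval's identity on the cube. -/
theorem sum_norm_sq_walsh (F : Finset (Finset ι)) (c : Finset ι → ℂ) :
    ∑ s : ι → Bool, ‖∑ S ∈ F, c S * walsh S s‖ ^ 2
      = 2 ^ Fintype.card ι * ∑ S ∈ F, ‖c S‖ ^ 2 := by
  have key : ∑ s : ι → Bool, (∑ S ∈ F, c S * walsh S s) * star (∑ S ∈ F, c S * walsh S s)
      = 2 ^ Fintype.card ι * ∑ S ∈ F, c S * star (c S) := by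
    have hsum (S T : Finset ι) :
        ∑ s : ι → Bool, c S * walsh S s * (star (c T) * walsh T s)
          = c S * star (c T) * if symmDiff S T = ∅ then 2 ^ Fintype.card ι else 0 := by
      rw [← sum_walsh, Finset.mul_sum]
      exact Finset.sum_congr rfl fun s _ => by rw [mul_mul_mul_comm, walsh_mul_walsh]
    simp_rw [star_sum, star_mul', star_walsh, Finset.sum_mul_sum]
    rw [Finset.sum_comm, Finset.mul_sum]
    refine Finset.sum_congr rfl fun S hS => ?_
    rw [Finset.sum_comm, Finset.sum_eq_single S]
    · rw [hsum]
      simp [mul_comm]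
    · intro T _ hT
      rw [hsum, if_neg, mul_zero]
      rw [← Finset.bot_eq_empty, symmDiff_eq_bot]
      exact hT.symm
    · exact fun h => absurd hS h
  simp only [Complex.star_def, Complex.mul_conj, Complex.normSq_eq_norm_sq] at key
  exact_mod_cast key

/-- The space of complex functions on the cube of degree at most `n`. -/
def lowDegree (ι : Type*) [Fintype ι] [DecidableEq ι] (n : ℕ) :
    Submodule ℂ ((ι → Bool) → ℂ) :=
  Submodule.span ℂ (walsh '' {S : Finset ι | S.card ≤ n})

theorem lowDegree_mono {m n : ℕ} (h : m ≤ n) : lowDegree ι m ≤ lowDegree ι n :=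
  Submodule.span_mono (Set.image_mono fun _ hS => le_trans hS h)

theorem const_mem_lowDegree (c : ℂ) (n : ℕ) : (fun _ => c) ∈ lowDegree ι n := by
  have h : walsh ∅ ∈ lowDegree ι n := Submodule.subset_span ⟨∅, by simp, rfl⟩
  convert Submodule.smul_mem _ c h using 1
  ext s
  simp [walsh]

/-- Any function of one bit is affine in its sign. -/
theorem eval_mem_lowDegree (i : ι) (h : Bool → ℂ) : (fun s => h (s i)) ∈ lowDegree ι 1 := by
  have hi : walsh {i} ∈ lowDegree ι 1 := Submodule.subset_span ⟨{i}, by simp, rfl⟩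
  convert Submodule.add_mem _ (const_mem_lowDegree ((h false + h true) / 2) 1)
    (Submodule.smul_mem _ ((h false - h true) / 2) hi) using 1
  ext s
  cases hs : s i <;> simp [walsh, boolSign, hs] <;> ring

theorem mul_mem_lowDegree {m n : ℕ} {a b : (ι → Bool) → ℂ} (ha : a ∈ lowDegree ι m)
    (hb : b ∈ lowDegree ι n) : a * b ∈ lowDegree ι (m + n) := by
  have h := Submodule.mul_mem_mul ha hb
  rw [lowDegree, lowDegree, Submodule.span_mul_span] at h
  refine Submodule.span_mono ?_ h
  rintro _ ⟨_, ⟨S, hS, rfl⟩, _, ⟨T, hT, rfl⟩, rfl⟩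
  refine ⟨symmDiff S T, ?_, funext fun s => (walsh_mul_walsh S T s).symm⟩
  have h1 : symmDiff S T ⊆ S ∪ T := symmDiff_le_sup
  exact (Finset.card_le_card h1).trans ((Finset.card_union_le S T).trans (add_le_add hS hT))

theorem prod_mem_lowDegree {κ : Type*} (t : Finset κ) (n : κ → ℕ) (a : κ → (ι → Bool) → ℂ)
    (h : ∀ l ∈ t, a l ∈ lowDegree ι (n l)) : ∏ l ∈ t, a l ∈ lowDegree ι (∑ l ∈ t, n l) := by
  classical
  induction t using Finset.induction_on with
  | empty => exact const_mem_lowDegree 1 _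
  | insert l t hl ih =>
    rw [Finset.prod_insert hl, Finset.sum_insert hl]
    exact mul_mem_lowDegree (h l (by simp)) (ih fun j hj => h j (by simp [hj]))

/-- A function of low degree cannot be concentrated at one point of the cube. -/
theorem norm_sq_le_of_mem_lowDegree {n : ℕ} {a : (ι → Bool) → ℂ} (ha : a ∈ lowDegree ι n)
    (s : ι → Bool) :
    2 ^ Fintype.card ι * ‖a s‖ ^ 2 ≤ numLow ι n * ∑ g, ‖a g‖ ^ 2 := by
  classical
  set F : Finset (Finset ι) := Finset.univ.filter fun S => S.card ≤ n
  have hF : {S : Finset ι | S.card ≤ n} = ↑F := by ext; simp [F]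
  rw [lowDegree, hF, Submodule.mem_span_image_finset_iff_exists_fun'] at ha
  obtain ⟨c, rfl⟩ := ha
  have hs (g : ι → Bool) : (∑ S ∈ F, c S • walsh S) g = ∑ S ∈ F, c S * walsh S g := by
    simp [Finset.sum_apply]
  simp_rw [hs, sum_norm_sq_walsh]
  -- Walsh functions have modulus 1, so Cauchy–Schwarz over the coefficients suffices; Parseval has
  -- already turned the right-hand side into their sum of squares.
  have h1 : ‖∑ S ∈ F, c S * walsh S s‖ ≤ ∑ S ∈ F, ‖c S‖ := by
    refine (norm_sum_le _ _).trans (le_of_eq (Finset.sum_congr rfl fun S _ => ?_))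
    rw [norm_mul, norm_walsh, mul_one]
  have h2 : ‖∑ S ∈ F, c S * walsh S s‖ ^ 2 ≤ F.card * ∑ S ∈ F, ‖c S‖ ^ 2 :=
    (pow_le_pow_left₀ (norm_nonneg _) h1 2).trans sq_sum_le_card_mul_sum_sq
  calc _ ≤ 2 ^ Fintype.card ι * (F.card * ∑ S ∈ F, ‖c S‖ ^ 2) := by gcongr
    _ = F.card * (2 ^ Fintype.card ι * ∑ S ∈ F, ‖c S‖ ^ 2) := by ring

/-- With `t = 1/16` in `numLow_mul_le`, fourth powers turn `16 ^ d` into `2 ^ (16 * d) ≤ 2 ^ N`.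
What remains is `(17/16) ^ 8 * 4 < 16`, with enough room for the factor `3/4` once `N ≥ 4`. -/
theorem numLow_mul_numLow_lt {N m n : ℕ} (hN : 4 ≤ N) (hm : 16 * m ≤ N) (hn : 16 * n ≤ N) :
    (numLow (Fin N) m * numLow (Fin N) n : ℝ) < 3 / 4 * 2 ^ N := by
  have h : ∀ d, 16 * d ≤ N → (numLow (Fin N) d : ℝ) ^ 4 ≤ (17 / 16 : ℝ) ^ (4 * N) * 2 ^ N := by
    intro d hd
    have h1 := numLow_mul_le (ι := Fin N) (n := d) (t := 1 / 16) (by norm_num) (by norm_num)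
    rw [Fintype.card_fin, one_div, inv_pow, ← div_eq_mul_inv, div_le_iff₀ (by positivity)] at h1
    calc (numLow (Fin N) d : ℝ) ^ 4 ≤ ((1 + 16⁻¹) ^ N * 16 ^ d) ^ 4 := by gcongr
      _ = (17 / 16 : ℝ) ^ (4 * N) * 2 ^ (16 * d) := by
        rw [mul_pow, ← pow_mul, ← pow_mul, mul_comm N, show (16 : ℝ) = 2 ^ 4 by norm_num,
          ← pow_mul]
        congr 2 <;> [norm_num; ring]
      _ ≤ _ := by gcongr; norm_num
  refine lt_of_pow_lt_pow_left₀ 4 (by positivity) ?_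
  calc (numLow (Fin N) m * numLow (Fin N) n : ℝ) ^ 4
      = (numLow (Fin N) m : ℝ) ^ 4 * (numLow (Fin N) n : ℝ) ^ 4 := mul_pow ..
    _ ≤ ((17 / 16 : ℝ) ^ (4 * N) * 2 ^ N) * ((17 / 16 : ℝ) ^ (4 * N) * 2 ^ N) := by
      gcongr
      exacts [h m hm, h n hn]
    _ = (((17 / 16 : ℝ) ^ 8 * 2 ^ 2) / 2 ^ 4) ^ N * (2 ^ 4) ^ N := by
      rw [← mul_pow, div_mul_cancel₀ _ (by norm_num), mul_pow, ← pow_mul, ← pow_mul]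
      ring
    _ < (3 / 4) ^ 4 * (2 ^ 4) ^ N := by
      gcongr
      calc (((17 / 16 : ℝ) ^ 8 * 2 ^ 2) / 2 ^ 4) ^ N ≤ (((17 / 16 : ℝ) ^ 8 * 2 ^ 2) / 2 ^ 4) ^ 4 :=
          pow_le_pow_of_le_one (by positivity) (by norm_num) hN
        _ < _ := by norm_num
    _ = (3 / 4 * 2 ^ N) ^ 4 := by rw [mul_pow, ← pow_mul, ← pow_mul, mul_comm 4 N]

end Walsh
end QuantumIBC

namespace QuantumIBC

/-! ### Unitarity and total probability -/

variable {D K G : Type*}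

open Classical in
theorem QuantumQuery.basisMap_symm (Q : QuantumQuery D K) (f : D → K) (i : Fin (2 ^ Q.m'))
    (x : Fin (2 ^ Q.m'')) (y : Fin (2 ^ (Q.m - Q.m' - Q.m''))) :
    Q.basisMap f ((splitBasis Q.m Q.m' Q.m'' Q.add_le).symm ((i, x), y))
      = (splitBasis Q.m Q.m' Q.m'' Q.add_le).symm
        ((i, if hi : i ∈ Q.Z then x + Q.β (f (Q.τ ⟨i, hi⟩)) else x), y) := by
  by_cases hi : i ∈ Q.Z <;> simp [basisMap, hi]

/-- The index `i` is preserved and determines the shift of `x`, so the shift can be undone. -/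
theorem QuantumQuery.basisMap_injective (Q : QuantumQuery D K) (f : D → K) :
    Function.Injective (Q.basisMap f) := by
  intro a b h
  obtain ⟨⟨⟨i, x⟩, y⟩, rfl⟩ := (splitBasis Q.m Q.m' Q.m'' Q.add_le).symm.surjective a
  obtain ⟨⟨⟨j, x'⟩, y'⟩, rfl⟩ := (splitBasis Q.m Q.m' Q.m'' Q.add_le).symm.surjective b
  rw [basisMap_symm, basisMap_symm, Equiv.apply_eq_iff_eq, Prod.mk.injEq, Prod.mk.injEq] at h
  obtain ⟨⟨rfl, h⟩, rfl⟩ := h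
  split_ifs at h
  · rw [add_left_injective _ h]
  · rw [h]

theorem QuantumQuery.op_mem_unitaryGroup (Q : QuantumQuery D K) (f : D → K) :
    Q.op f ∈ Matrix.unitaryGroup (Fin (2 ^ Q.m)) ℂ := by
  rw [Matrix.mem_unitaryGroup_iff']
  ext a b
  simp [op, Matrix.mul_apply, Matrix.star_apply, Matrix.one_apply,
    (Q.basisMap_injective f).eq_iff, eq_comm]

theorem UnmeasuredAlgorithm.op_mem_unitaryGroup (A : UnmeasuredAlgorithm D K) (f : D → K) :
    A.op f ∈ Matrix.unitaryGroup (Fin (2 ^ A.m)) ℂ := by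
  unfold op
  induction Fin.last A.n using Fin.induction with
  | zero => exact (A.U 0).2
  | succ j ih => exact mul_mem (mul_mem (A.U j.succ).2 (A.Q.op_mem_unitaryGroup f)) ih

theorem sum_norm_sq_of_mem_unitaryGroup {α : Type*} [Fintype α] [DecidableEq α]
    {M : Matrix α α ℂ} (h : M ∈ Matrix.unitaryGroup α ℂ) (b : α) : ∑ a, ‖M a b‖ ^ 2 = 1 := by
  have h1 := congrFun (congrFun (Matrix.mem_unitaryGroup_iff'.mp h) b) b
  simp only [Matrix.mul_apply, Matrix.star_apply, Complex.star_def, Complex.conj_mul',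
    Matrix.one_apply_eq] at h1
  exact_mod_cast h1

/-- The total mass of a product of successive transition probabilities. -/
theorem sum_prod_transition_eq_one {k : ℕ} (X : Fin k → Type*) [∀ l, Fintype (X l)]
    [∀ l, Nonempty (X l)] (P : Fin k → (∀ l, X l) → ℝ)
    (hP : ∀ l x x', (∀ i ≤ l, x i = x' i) → P l x = P l x')
    (hsum : ∀ l x, ∑ y, P l (Function.update x l y) = 1) : ∑ x, ∏ l, P l x = 1 := by
  induction k with
  | zero => simp
  | succ k ih =>
    obtain ⟨d⟩ : Nonempty (X (Fin.last k)) := inferInstance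
    have h1 := ih (fun l => X l.castSucc)
      (fun l x => P l.castSucc (Fin.snoc (α := X) x d)) ?_ ?_
    · rw [← (Fin.snocEquiv X).sum_comp, Fintype.sum_prod_type, Finset.sum_comm, ← h1]
      refine Finset.sum_congr rfl fun x _ => ?_
      have h2 : ∀ y l, P (Fin.castSucc l) (Fin.snocEquiv X (y, x))
          = P l.castSucc (Fin.snoc (α := X) x d) := by
        intro y l
        refine hP _ _ _ fun i hi => ?_
        obtain ⟨i, rfl⟩ : ∃ j : Fin k, j.castSucc = i :=
          ⟨i.castPred (ne_of_lt (hi.trans_lt (Fin.castSucc_lt_last l))), by simp⟩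
        simp [Fin.snocEquiv]
      simp_rw [Fin.prod_univ_castSucc, h2, ← Finset.mul_sum]
      have h3 := hsum (Fin.last k) (Fin.snoc (α := X) x d)
      simp only [Fin.update_snoc_last] at h3
      rw [show ∑ y, P (Fin.last k) (Fin.snocEquiv X (y, x)) = 1 from h3, mul_one]
    · intro l x x' h
      refine hP _ _ _ fun i hi => ?_
      obtain ⟨i, rfl⟩ : ∃ j : Fin k, j.castSucc = i :=
        ⟨i.castPred (ne_of_lt (hi.trans_lt (Fin.castSucc_lt_last l))), by simp⟩
      simpa using h i (by simpa using hi)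
    · intro l x
      simp only [Fin.snoc_update]
      exact hsum l.castSucc _

theorem QuantumAlgorithm.sum_outcomeProb (A : QuantumAlgorithm D K G) (f : D → K) :
    ∑ x, A.outcomeProb f x = 1 := by
  refine sum_prod_transition_eq_one _
    (fun l x => ‖(A.A l).op f (x l) (A.b l fun i => x i)‖ ^ 2) ?_ ?_
  · intro l x x' h
    simp only [h l le_rfl]
    congr 5
    ext i : 1
    exact h i (le_of_lt i.2)
  · intro l x
    rw [← sum_norm_sq_of_mem_unitaryGroup ((A.A l).op_mem_unitaryGroup f) (A.b l fun i => x i)]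
    refine Finset.sum_congr rfl fun y _ => ?_
    rw [Function.update_self]
    congr 4
    ext i : 1
    rw [Function.update_of_ne (ne_of_lt i.2)]

open Classical in
theorem QuantumAlgorithm.outputProb_add_compl (A : QuantumAlgorithm D K G) (f : D → K)
    (C : Set G) : A.outputProb f C + A.outputProb f Cᶜ = 1 := by
  rw [← A.sum_outcomeProb f]
  unfold outputProb
  convert Finset.sum_filter_add_sum_filter_not Finset.univ (fun x => A.φ x ∈ C) (A.outcomeProb f)

theorem QuantumAlgorithm.outcomeProb_nonneg (A : QuantumAlgorithm D K G) (f : D → K)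
    (x : (l : Fin A.k) → Fin (2 ^ (A.A l).m)) : 0 ≤ A.outcomeProb f x :=
  Finset.prod_nonneg fun _ _ => sq_nonneg _

theorem QuantumAlgorithm.outputProb_mono (A : QuantumAlgorithm D K G) (f : D → K)
    {C C' : Set G} (h : C ⊆ C') : A.outputProb f C ≤ A.outputProb f C' := by
  classical
  unfold outputProb
  refine Finset.sum_le_sum_of_subset_of_nonneg ?_ fun x _ _ => A.outcomeProb_nonneg f x
  intro x
  simp only [Finset.mem_filter, Finset.mem_univ, true_and]
  exact fun hx => h hx

/-! ### Amplitudes have low degree on the cube of sign functions -/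

section Degree

variable {ι : Type*} [Fintype ι] [DecidableEq ι]

/-- The real sign function encoded by a point of the cube. -/
def signFun (s : ι → Bool) (i : ι) : ℝ := boolSign ℝ (s i)

/-- The column `b` fixes the index `i`, so an entry depends on at most the single bit at `τ i`. -/
theorem QuantumQuery.op_mem_lowDegree (Q : QuantumQuery ι ℝ) (a b : Fin (2 ^ Q.m)) :
    (fun s => Q.op (signFun s) a b) ∈ lowDegree ι 1 := by
  simp only [op, Matrix.of_apply, basisMap]
  by_cases hi : ((splitBasis Q.m Q.m' Q.m'' Q.add_le) b).1.1 ∈ Q.Z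
  · simp only [hi, dite_true, signFun]
    exact eval_mem_lowDegree (Q.τ ⟨_, hi⟩) fun c => if a =
      (splitBasis Q.m Q.m' Q.m'' Q.add_le).symm ((_, _ + Q.β (boolSign ℝ c)), _) then 1 else 0
  · simp only [hi, dite_false]
    exact const_mem_lowDegree _ _

theorem mul_apply_mem_lowDegree {α β γ : Type*} [Fintype β] {m n : ℕ}
    {M : (ι → Bool) → Matrix α β ℂ} {M' : (ι → Bool) → Matrix β γ ℂ}
    (hM : ∀ a b, (fun s => M s a b) ∈ lowDegree ι m)
    (hM' : ∀ b c, (fun s => M' s b c) ∈ lowDegree ι n) (a : α) (c : γ) :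
    (fun s => (M s * M' s) a c) ∈ lowDegree ι (m + n) := by
  have h : (fun s => (M s * M' s) a c)
      = ∑ b, (fun s => M s a b) * (fun s => M' s b c) := by
    ext s
    simp [Matrix.mul_apply]
  rw [h]
  exact Submodule.sum_mem _ fun b _ => mul_mem_lowDegree (hM a b) (hM' b c)

theorem UnmeasuredAlgorithm.op_mem_lowDegree (A : UnmeasuredAlgorithm ι ℝ)
    (a b : Fin (2 ^ A.m)) : (fun s => A.op (signFun s) a b) ∈ lowDegree ι A.n := by
  -- The `U_j` are constant in `s`, so only the factors `Q_f` raise the degree, each by one.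
  have h : ∀ (j : Fin (A.n + 1)) (a b : Fin (2 ^ A.Q.m)), (fun s : ι → Bool =>
      Fin.induction (motive := fun _ => Matrix (Fin (2 ^ A.Q.m)) (Fin (2 ^ A.Q.m)) ℂ)
        (A.U 0 : Matrix (Fin (2 ^ A.Q.m)) (Fin (2 ^ A.Q.m)) ℂ)
        (fun j M => (A.U j.succ : Matrix (Fin (2 ^ A.Q.m)) (Fin (2 ^ A.Q.m)) ℂ)
          * A.Q.op (signFun s) * M) j a b) ∈ lowDegree ι j := by
    intro j
    induction j using Fin.induction with
    | zero => exact fun a b => const_mem_lowDegree _ _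
    | succ j ih =>
      intro a b
      have h1 := mul_apply_mem_lowDegree (mul_apply_mem_lowDegree (ι := ι)
        (fun a b => const_mem_lowDegree
          ((A.U j.succ : Matrix (Fin (2 ^ A.Q.m)) (Fin (2 ^ A.Q.m)) ℂ) a b) 0)
        A.Q.op_mem_lowDegree) ih a b
      have h2 : 0 + 1 + (j.castSucc : ℕ) = (j.succ : ℕ) := by simp [add_comm]
      rw [h2] at h1
      exact h1
  exact h (Fin.last A.n) a b

/-- The averaged probability that an algorithm with few queries locates an unknown point of
the cube. -/
theorem QuantumAlgorithm.sum_outputProb_le (A : QuantumAlgorithm ι ℝ G) {n V : ℕ}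
    (hn : A.numQueries ≤ n) (C : (ι → Bool) → Set G)
    (hC : ∀ g, {s | g ∈ C s}.ncard ≤ V) :
    ∑ s, A.outputProb (signFun s) (C s) ≤ V * numLow ι n := by
  classical
  set W : ℝ := 2 ^ Fintype.card ι with hW
  have hW0 : 0 < W := by positivity
  have hpt : ∀ x s, A.outcomeProb (signFun s) x
      ≤ numLow ι n / W * ∑ g, A.outcomeProb (signFun g) x := by
    intro x s
    -- Once `x` is fixed, so are all the initial states, and adaptivity plays no role: the degrees
    -- of the stages add up to the total number of queries.
    have hmem : (∏ l, fun s => (A.A l).op (signFun s) (x l) (A.b l fun i => x i))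
        ∈ lowDegree ι n :=
      lowDegree_mono hn (prod_mem_lowDegree _ _ _ fun l _ => (A.A l).op_mem_lowDegree _ _)
    have h := norm_sq_le_of_mem_lowDegree hmem s
    simp only [Finset.prod_apply, norm_prod, ← Finset.prod_pow] at h
    rw [div_mul_eq_mul_div, le_div_iff₀ hW0, mul_comm]
    exact h
  calc ∑ s, A.outputProb (signFun s) (C s)
      = ∑ x, ∑ s with A.φ x ∈ C s, A.outcomeProb (signFun s) x := by
        simp only [outputProb, Finset.sum_filter]
        rw [Finset.sum_comm]
    _ ≤ ∑ x, V * (numLow ι n / W * ∑ g, A.outcomeProb (signFun g) x) := by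
        -- For fixed `x` the output `A.φ x` is a single element of `G`, which lies in `C s` for at
        -- most `V` points `s`.
        refine Finset.sum_le_sum fun x _ => ?_
        refine (Finset.sum_le_card_nsmul _ _ _ fun s _ => hpt x s).trans ?_
        rw [nsmul_eq_mul]
        have h0 : 0 ≤ ∑ g : ι → Bool, A.outcomeProb (signFun g) x :=
          Finset.sum_nonneg fun g _ => A.outcomeProb_nonneg _ x
        refine mul_le_mul_of_nonneg_right ?_ (by positivity)
        have := hC (A.φ x)
        rw [Set.ncard_eq_toFinset_card'] at this
        rw [← Set.toFinset_ofPred]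
        exact_mod_cast this
    _ = V * numLow ι n := by
        rw [← Finset.mul_sum, ← Finset.mul_sum, Finset.sum_comm]
        simp only [sum_outcomeProb, Finset.sum_const, Finset.card_univ, nsmul_eq_mul, mul_one,
          Fintype.card_pi, Fintype.card_bool, Finset.prod_const]
        push_cast
        rw [div_mul_cancel₀ _ hW0.ne']

end Degree
end QuantumIBC

namespace QuantumIBC

/-! ### Sign functions in the spaces `L_p^N` -/

theorem abs_signFun {ι : Type*} (s : ι → Bool) (i : ι) : |signFun s i| = 1 := by
  unfold signFun
  cases s i <;> simp [boolSign]

theorem abs_signFun_sub {ι : Type*} (s s' : ι → Bool) (i : ι) :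
    |signFun s i - signFun s' i| = if s i ≠ s' i then 2 else 0 := by
  unfold signFun
  cases s i <;> cases s' i <;> norm_num [boolSign]

variable {N : ℕ}

theorem signFun_mem_unitBall (p : ℝ≥0∞) (hN : 0 < N) (s : Fin N → Bool) :
    signFun s ∈ LpN.unitBall p N := by
  have : Nonempty (Fin N) := ⟨⟨0, hN⟩⟩
  have h (i : Fin N) : |LpN.of p N (signFun s) i| = 1 := abs_signFun s i
  rw [LpN.unitBall, Set.mem_ofPred_eq, LpN.norm_def]
  simp_rw [h]
  have hN' : (N : ℝ) ≠ 0 := by positivity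
  split_ifs <;> simp [hN']

/-- For finite `q`, sign functions at Hamming distance `d` are `2 * (d / N) ^ (1 / q)` apart, so `d
/ N ≤ (1/16) ^ q ≤ 1/16` as `q ≥ 1`. For `q = ∞` distinct ones are 2 apart. -/
theorem sixteen_mul_hammingDist_le (q : ℝ≥0∞) [hq : Fact (1 ≤ q)] (s s' : Fin N → Bool)
    (h : ‖LpN.of q N (signFun s) - LpN.of q N (signFun s')‖ ≤ 1 / 8) :
    16 * hammingDist s s' ≤ N := by
  have hd (i : Fin N) : |(LpN.of q N (signFun s) - LpN.of q N (signFun s')) i|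
      = if s i ≠ s' i then 2 else 0 := abs_signFun_sub s s' i
  rw [LpN.norm_def] at h
  simp_rw [hd] at h
  split_ifs at h with hq'
  · have h0 : s = s' := by
      ext i : 1
      by_contra hi
      have h1 := le_ciSup (f := fun i => if s i ≠ s' i then (2 : ℝ) else 0)
        (Set.finite_range _).bddAbove i
      simp only [ne_eq, hi, not_false_eq_true, if_true] at h1
      simp only [ne_eq] at h
      linarith
    simp [h0]
  · rcases Nat.eq_zero_or_pos N with rfl | hN
    · simp [hammingDist]
    have hr : 1 ≤ q.toReal := by
      simpa using ENNReal.toReal_mono hq' hq.out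
    have hr0 : 0 < q.toReal := by linarith
    have hsum : ∑ i, (if s i ≠ s' i then (2 : ℝ) else 0) ^ q.toReal
        = hammingDist s s' * 2 ^ q.toReal := by
      rw [hammingDist, ← nsmul_eq_mul, ← Finset.sum_const, Finset.sum_filter]
      refine Finset.sum_congr rfl fun i _ => ?_
      split_ifs <;> simp [hr0.ne']
    rw [hsum, one_div q.toReal, Real.rpow_inv_le_iff_of_pos (by positivity) (by norm_num) hr0]
      at h
    have h1 : (hammingDist s s' : ℝ) / N ≤ (1 / 16) ^ q.toReal := by
      rw [show (1 / 16 : ℝ) = 1 / 8 / 2 by norm_num, Real.div_rpow (by norm_num) (by norm_num),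
        le_div_iff₀ (by positivity)]
      refine le_trans (le_of_eq ?_) h
      ring
    have h2 : (1 / 16 : ℝ) ^ q.toReal ≤ 1 / 16 := by
      simpa using Real.rpow_le_rpow_of_exponent_ge (by norm_num : (0 : ℝ) < 1 / 16)
        (by norm_num) hr
    have h3 := h1.trans h2
    rw [div_le_div_iff₀ (by positivity) (by norm_num)] at h3
    have : (16 * hammingDist s s' : ℝ) ≤ N := by linarith
    exact_mod_cast this

/-- The centre `g` need not be a sign function; re-centring at a sign function in the ball doubles
the radius to `1/8`. -/
theorem ncard_signFun_near_le (q : ℝ≥0∞) [Fact (1 ≤ q)] (g : LpN q N) :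
    {s | ‖LpN.of q N (signFun s) - g‖ ≤ 1 / 16}.ncard ≤ numLow (Fin N) (N / 16) := by
  rcases Set.eq_empty_or_nonempty {s | ‖LpN.of q N (signFun s) - g‖ ≤ 1 / 16} with h | ⟨s, hs⟩
  · rw [h, Set.ncard_empty]
    exact Nat.zero_le _
  · refine (Set.ncard_le_ncard (fun s' hs' => ?_) (Set.toFinite _)).trans
      (card_hammingDist_le s (N / 16))
    have h1 := norm_sub_le_norm_sub_add_norm_sub (LpN.of q N (signFun s)) g
      (LpN.of q N (signFun s'))
    rw [norm_sub_rev g] at h1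
    have h2 := sixteen_mul_hammingDist_le q s s'
      (by simp only [Set.mem_ofPred_eq] at hs hs'; linarith)
    simp only [Set.mem_ofPred_eq]
    omega

/-- With at most `N / 16` queries the error of the embedding stays bounded below by a constant,
for all values of `p` and `q`. -/
theorem le_embeddingError (p q : ℝ≥0∞) [Fact (1 ≤ q)] {n : ℕ} (hN : 4 ≤ N)
    (hn : 16 * n ≤ N) : ENNReal.ofReal (1 / 16) ≤ embeddingError n p q N := by
  refine le_iInf₂ fun A hA => ?_
  by_contra! hlt
  have hprob (s : Fin N → Bool) : 3 / 4 ≤ A.outputProb (signFun s)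
      {g | ‖LpN.of q N (signFun s) - g‖ ≤ 1 / 16} := by
    have h1 := (le_iSup (fun f : LpN.unitBall p N => errorAt
      (fun f : LpN.unitBall p N => LpN.J p q N (LpN.of p N f)) A f (1 / 4))
      ⟨signFun s, signFun_mem_unitBall p (by omega) s⟩).trans_lt hlt
    obtain ⟨ε, hε⟩ := iInf_lt_iff.mp h1
    obtain ⟨hε, hε'⟩ := iInf_lt_iff.mp hε
    have hε1 : (ε : ℝ) < 1 / 16 := by
      have h2 := (ENNReal.toReal_lt_toReal (by simp) (by simp)).mpr hε'
      simpa using h2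
    have h3 := A.outputProb_add_compl (signFun s) {g | (ε : ℝ) < ‖LpN.of q N (signFun s) - g‖}
    have h4 : A.outputProb (signFun s) {g | (ε : ℝ) < ‖LpN.of q N (signFun s) - g‖} ≤ 1 / 4 := hε
    have h5 : A.outputProb (signFun s) {g | (ε : ℝ) < ‖LpN.of q N (signFun s) - g‖}ᶜ
        ≤ A.outputProb (signFun s) {g | ‖LpN.of q N (signFun s) - g‖ ≤ 1 / 16} := by
      refine A.outputProb_mono _ fun g hg => ?_
      simp only [Set.mem_compl_iff, Set.mem_ofPred_eq, not_lt] at hg ⊢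
      linarith
    linarith
  have h1 := A.sum_outputProb_le hA
    (fun s => {g | ‖LpN.of q N (signFun s) - g‖ ≤ 1 / 16}) (ncard_signFun_near_le q)
  have h2 := Finset.sum_le_sum fun (s : Fin N → Bool) (_ : s ∈ Finset.univ) => hprob s
  have h3 : ∑ _s : Fin N → Bool, (3 / 4 : ℝ) = 3 / 4 * 2 ^ N := by simp [mul_comm]
  have h4 := numLow_mul_numLow_lt hN (Nat.mul_div_le N 16) hn
  linarith

end QuantumIBC

/-! ### The three cases from the uniform bound -/

theorem proposition7 (p q : ℝ≥0∞) [Fact (1 ≤ p)] [Fact (1 ≤ q)] :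
    ∃ c₀ c₁ : ℝ, 0 < c₀ ∧ 0 < c₁ ∧
      ∀ n N : ℕ, 1 ≤ n → 4 < N → (n : ℝ) ≤ c₀ * N →
        (2 < q →
          ENNReal.ofReal c₁ ≤ QuantumIBC.embeddingError n p q N) ∧
        (q = 2 →
          ENNReal.ofReal (c₁ * (Real.logb 2 (Real.logb 2 N)) ^ (-(3 / 2) : ℝ) *
              (Real.logb 2 (Real.logb 2 (Real.logb 2 N)))⁻¹)
            ≤ QuantumIBC.embeddingError n p q N) ∧
        (q < 2 →
          ENNReal.ofReal (c₁ * (Real.logb 2 N) ^ (1 - 2 / q.toReal))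
            ≤ QuantumIBC.embeddingError n p q N) := by
  refine ⟨1 / 16, 1 / 16, by norm_num, by norm_num, fun n N hn hN hnN => ?_⟩
  have hnN' : 16 * n ≤ N := by
    have : (16 * n : ℝ) ≤ N := by linarith
    exact_mod_cast this
  have key := QuantumIBC.le_embeddingError p q hN.le hnN'
  -- Since `n ≥ 1`, the condition `16 * n ≤ N` forces `N ≥ 16 = 2 ^ (2 ^ 2)`, which puts the
  -- iterated logarithms at or above 4, 2 and 1.
  have hN16 : (16 : ℝ) ≤ N := by exact_mod_cast (by omega : 16 ≤ N)
  have hlog {x y z : ℝ} (hz : (2 : ℝ) ^ y = z) (hz0 : 0 < z) (hx : z ≤ x) : y ≤ Real.logb 2 x := by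
    rwa [Real.le_logb_iff_rpow_le (by norm_num) (hz0.trans_le hx), hz]
  have h1 : 4 ≤ Real.logb 2 N := hlog (by norm_num) (by norm_num) hN16
  have h2 : 2 ≤ Real.logb 2 (Real.logb 2 N) := hlog (by norm_num) (by norm_num) h1
  have h3 : 1 ≤ Real.logb 2 (Real.logb 2 (Real.logb 2 N)) :=
    hlog (by norm_num) (by norm_num) h2
  refine ⟨fun _ => key, fun _ => ?_, fun hq => ?_⟩
  · refine le_trans (ENNReal.ofReal_le_ofReal ?_) key
    have h4 : Real.logb 2 (Real.logb 2 N) ^ (-(3 / 2) : ℝ) ≤ 1 :=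
      Real.rpow_le_one_of_one_le_of_nonpos (by linarith) (by norm_num)
    have h5 : (Real.logb 2 (Real.logb 2 (Real.logb 2 N)))⁻¹ ≤ 1 := inv_le_one_of_one_le₀ h3
    rw [mul_assoc]
    refine mul_le_of_le_one_right (by norm_num) (mul_le_one₀ h4 (by positivity) h5)
  · refine le_trans (ENNReal.ofReal_le_ofReal ?_) key
    have hq1 : 1 ≤ q.toReal := by
      simpa using ENNReal.toReal_mono (hq.trans_le le_top).ne (Fact.out : 1 ≤ q)
    have hq2 : q.toReal ≤ 2 := by
      simpa using ENNReal.toReal_mono (by simp) hq.le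
    refine mul_le_of_le_one_right (by norm_num)
      (Real.rpow_le_one_of_one_le_of_nonpos (by linarith) ?_)
    rw [sub_nonpos, le_div_iff₀ (by linarith)]
    linarith
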